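/- **Setting.** For $k\in\mathbb N$ let $k_+=\{0,1,\dots,k\}$, pointed at $0$. An *s-module* (Segal $\Gamma$-set) is a functor $F$ from the category of the pointed sets $k_+$ and pointed maps to pointed sets such that $F(0_+)$ is a point. It is extended to all pointed sets $Y$ by $F(Y)=\operatorname{colim}_{k_+\to Y}F(k_+)$. The s-module $H\mathbb R$ is given by $H\mathbb R(k_+)=\mathbb R^k$ and $(f_*\varphi)_j=\sum_{i\ge 1,\,f(i)=j}\varphi_i$ for $1\le j\le l$ and a pointed map $f\colon k_+\to l_+$; for $\lambda>0$ the sub-s-module $\|H\mathbb R\|_\lambda\subset H\mathbb R$ is $$\|H\mathbb R\|_\lambda(k_+)=\Bigl\{\varphi\in\mathbb R^k \Bigm| \sum_{i=1}^k|\varphi_i|<\lambda\Bigr\}.$$ For a pointed simplicial set $W$ let $\pi_n(W)$ be the set of all $x\in W_n$ all of whose faces are the base point $*$, modulo the equivalence relation generated by: $x\sim y$ if there is $z\in W_{n+1}$ with $\partial_jz=*$ for $j<n$, $\partial_nz=x$ and $\partial_{n+1}z=y$. For a topological space $X$ with singular simplicial set $S(X)$ and an s-module $F$ put $H_n(X;F)=\pi_n(F\circ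 S(X)_+)$, where $S(X)_+$ is $S(X)$ with a disjoint base point added. Since $H\mathbb R(S_n(X)_+)$ is the real vector space $C_n(X;\mathbb R)$ with basis the set $S_n(X)$ of singular $n$-simplices, sending $x$ to the homology class of the corresponding singular cycle gives a map $H_n(X;H\mathbb R)\to H_n(X;\mathbb R)$. The *canonical map* $\rho_{n,\lambda}\colon H_n(X;\|H\mathbb R\|_\lambda)\to H_n(X;\mathbb R)$ is its composition with the map induced by the inclusion $\|H\mathbb R\|_\lambda\subset H\mathbb R$. The *$\ell^1$-semi-norm* of $\alpha\in H_n(X;\mathbb R)$ is $$\|\alpha\|_1=\inf\Bigl\{\sum_{\sigma}|a_\sigma| \Bigm| \sum_\sigma a_\sigma\sigma\in C_n(X;\mathbb R)\text{ is a cycle representing }\alpha\Bigr\},$$ and its *Connes–Consani semi-norm* is $\inf\{\lambda>0\mid \alpha\in\operatorname{im}\rho_{n,\lambda}\}$. **Theorem.** Let $X$ be a topological space, $n\in\mathbb N$ (with $n=0$ allowed) and $\alpha\in H_n(X;\mathbb R)$. Then for every real $\lambda>0$, $$\|\alpha\|_1<\lambda\iff \alpha\in\operatorname{im}\bigl(\rho_{n,\lambda}\colon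 H_n(X;\|H\mathbb R\|_\lambda)\to H_n(X;\mathbb R)\bigr).$$ In particular, the Connes–Consani semi-norm of $\alpha$ equals $\|\alpha\|_1$. -/

import Mathlib

open CategoryTheory Opposite

universe u

/-- The category `Γᵒᵖ`: one object `k₊ = {0, …, k}`, pointed at `0`, for every natural number `k`,
and the base-point preserving maps as morphisms. -/
structure GammaOp : Type where
  card : ℕ

namespace GammaOp

instance : Category GammaOp where
  Hom k l := {f : Fin (k.card + 1) → Fin (l.card + 1) // f 0 = 0}
  id _ := ⟨id, rfl⟩
  comp f g := ⟨g.1 ∘ f.1, by simp [f.2, g.2]⟩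

end GammaOp

/-- An s-module (Segal's Γ-set): a functor from `Γᵒᵖ` to pointed sets sending `0₊` to a point. -/
structure SModule where
  toFunctor : GammaOp ⥤ Pointed.{0}
  subsingleton_zero : Subsingleton (toFunctor.obj ⟨0⟩)

namespace SModule

/-- Representatives of the elements of `F(Y)`, for `Y` an arbitrary pointed set: a pointed map
`k₊ → Y` together with an element of `F(k₊)`. -/
structure Pre (F : SModule) (Y : Pointed.{u}) : Type u where
  k : GammaOp
  pt : Fin (k.card + 1) → Y.X
  pt_zero : pt 0 = Y.point
  coeff : (F.toFunctor.obj k).X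

/-- The relation `(y ∘ f, x) ∼ (y, F(f) x)` for `f : k₊ → l₊`, `y : l₊ → Y` and `x ∈ F(k₊)`. -/
inductive PreRel (F : SModule) (Y : Pointed.{u}) : F.Pre Y → F.Pre Y → Prop
  | mk {k l : GammaOp} (f : k ⟶ l) (y : Fin (l.card + 1) → Y.X) (hy : y 0 = Y.point)
      (x : (F.toFunctor.obj k).X) :
      PreRel F Y ⟨k, y ∘ f.1, by simp [f.2, hy], x⟩ ⟨l, y, hy, (F.toFunctor.map f).toFun x⟩

/-- The value of an s-module on an arbitrary pointed set `Y`: the colimit of the `F(k₊)` over the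
pointed maps `k₊ → Y` (the left Kan extension; equivalently, the filtered colimit over the finite
pointed subsets of `Y`). -/
def extObj (F : SModule) (Y : Pointed.{u}) : Pointed.{u} where
  X := Quot (F.PreRel Y)
  point := Quot.mk _ ⟨⟨0⟩, fun _ => Y.point, rfl, (F.toFunctor.obj ⟨0⟩).point⟩

def extMap (F : SModule) {Y Z : Pointed.{u}} (g : Y ⟶ Z) : F.extObj Y ⟶ F.extObj Z where
  toFun := Quot.map
    (fun p => ⟨p.k, g.toFun ∘ p.pt, by simp [p.pt_zero, g.map_point], p.coeff⟩)
    (by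
      rintro _ _ ⟨f, y, hy, x⟩
      exact PreRel.mk f (g.toFun ∘ y) (by simp [hy, g.map_point]) x)
  map_point := by
    refine congrArg (Quot.mk _) ?_
    have : g.toFun ∘ (fun _ : Fin (0 + 1) => Y.point) = fun _ => Z.point := by
      funext; exact g.map_point
    simp [this]

/-- The extension of an s-module to an endofunctor of pointed sets. -/
def ext (F : SModule) : Pointed.{u} ⥤ Pointed.{u} where
  obj := F.extObj
  map := F.extMap
  map_id Y := by
    apply Pointed.Hom.ext
    funext x
    induction x using Quot.ind
    rfl
  map_comp f g := by
    apply Pointed.Hom.ext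
    funext x
    induction x using Quot.ind
    rfl

/-- A morphism of s-modules induces a natural map between the extensions. -/
def extNatTrans {F G : SModule} (φ : F.toFunctor ⟶ G.toFunctor) : F.ext ⟶ G.ext.{u} where
  app Y :=
    { toFun := Quot.map (fun p => ⟨p.k, p.pt, p.pt_zero, (φ.app p.k).toFun p.coeff⟩) (by
        rintro _ _ ⟨f, y, hy, x⟩
        have h := congrFun (congrArg Pointed.Hom.toFun (φ.naturality f)) x
        simp only [Pointed.Hom.comp_toFun', Function.comp_apply] at h
        rw [h]
        exact PreRel.mk f y hy _)
      map_point := by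
        refine congrArg (Quot.mk _) ?_
        simp [(φ.app _).map_point] }
  naturality Y Z g := by
    apply Pointed.Hom.ext
    funext x
    induction x using Quot.ind
    rfl

end SModule

namespace PointedSimplicial

/-- `x ∈ Wₙ` is spherical if all its faces are the base point. -/
def IsSpherical (W : SimplicialObject Pointed.{u}) : (n : ℕ) → (W.obj (op (.mk n))).X → Prop
  | 0, _ => True
  | n + 1, x => ∀ j : Fin (n + 2), (W.δ j).toFun x = (W.obj (op (.mk n))).point

/-- Spherical `n`-simplices `x`, `y` are related if there is `z ∈ Wₙ₊₁` with `∂ⱼ z = *` for `j < n`,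
`∂ₙ z = x` and `∂ₙ₊₁ z = y`. -/
def HomotopyRel (W : SimplicialObject Pointed.{u}) (n : ℕ)
    (x y : {x : (W.obj (op (.mk n))).X // IsSpherical W n x}) : Prop :=
  ∃ z : (W.obj (op (.mk (n + 1)))).X,
    (∀ j : Fin (n + 2), j.val < n → (W.δ j).toFun z = (W.obj (op (.mk n))).point) ∧
    (W.δ (Fin.last n).castSucc).toFun z = x.1 ∧
    (W.δ (Fin.last (n + 1))).toFun z = y.1

/-- The combinatorial homotopy `πₙ(W)`: spherical `n`-simplices modulo the equivalence relation
generated by `HomotopyRel`. -/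
def homotopy (W : SimplicialObject Pointed.{u}) (n : ℕ) : Type u :=
  Quot (HomotopyRel W n)

theorem naturality_δ {W W' : SimplicialObject Pointed.{u}} (φ : W ⟶ W') {n : ℕ} (j : Fin (n + 2))
    (x : (W.obj (op (.mk (n + 1)))).X) :
    (W'.δ j).toFun ((φ.app _).toFun x) = (φ.app _).toFun ((W.δ j).toFun x) :=
  (congrFun (congrArg Pointed.Hom.toFun (φ.naturality (SimplexCategory.δ j).op)) x).symm

theorem IsSpherical.map {W W' : SimplicialObject Pointed.{u}} (φ : W ⟶ W') :
    ∀ {n : ℕ} {x : (W.obj (op (.mk n))).X}, IsSpherical W n x → IsSpherical W' n ((φ.app _).toFun x)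
  | 0, _, _ => trivial
  | n + 1, x, h => fun j => by
      rw [naturality_δ, h j, Pointed.Hom.map_point]

def homotopyMap {W W' : SimplicialObject Pointed.{u}} (φ : W ⟶ W') (n : ℕ) :
    homotopy W n → homotopy W' n :=
  Quot.map (fun x => ⟨(φ.app _).toFun x.1, x.2.map φ⟩) (by
    rintro x y ⟨z, h0, h1, h2⟩
    refine ⟨(φ.app _).toFun z, fun j hj => ?_, ?_, ?_⟩
    · rw [naturality_δ, h0 j hj, Pointed.Hom.map_point]
    · rw [naturality_δ, h1]
    · rw [naturality_δ, h2])

end PointedSimplicial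

namespace SModule

open PointedSimplicial

/-- The pointed simplicial set `F ∘ K₊`, where `K₊` is `K` with a disjoint base point. -/
def onSSet (F : SModule) (K : SSet.{u}) : SimplicialObject Pointed.{u} :=
  ((SimplicialObject.whiskering _ _).obj (typeToPointed ⋙ F.ext)).obj K

/-- The homology `Hₙ(K; F) = πₙ(F ∘ K₊)` of a simplicial set with coefficients in an s-module. -/
def homology (F : SModule) (K : SSet.{u}) (n : ℕ) : Type u :=
  homotopy (F.onSSet K) n

/-- Functoriality of homology in the s-module. -/
def homologyMap {F G : SModule} (φ : F.toFunctor ⟶ G.toFunctor) (K : SSet.{u}) (n : ℕ) :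
    F.homology K n → G.homology K n :=
  homotopyMap (Functor.whiskerLeft K (Functor.whiskerLeft typeToPointed (extNatTrans φ))) n

/-- Push-forward of a tuple `φ : k₊ ∖ {0} → A` along `f : k₊ → l₊`: sum over the fibres, where the
fibre over the base point is dropped. -/
def push {A : Type} [AddCommMonoid A] {k l : GammaOp} (f : k ⟶ l) (φ : Fin k.card → A) :
    Fin l.card → A :=
  fun j => ∑ i with f.1 i.succ = j.succ, φ i

theorem push_id {A : Type} [AddCommMonoid A] {k : GammaOp} (φ : Fin k.card → A) :
    push (𝟙 k) φ = φ := by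
  funext j
  have h : ∀ i : Fin k.card, (𝟙 k : k ⟶ k).1 i.succ = i.succ := fun _ => rfl
  simp only [push, h, Fin.succ_inj]
  simp [Finset.sum_filter]

theorem push_comp {A : Type} [AddCommMonoid A] {k l m : GammaOp} (f : k ⟶ l) (g : l ⟶ m)
    (φ : Fin k.card → A) : push (f ≫ g) φ = push g (push f φ) := by
  funext j
  have h : ∀ i, (f ≫ g).1 i = g.1 (f.1 i) := fun _ => rfl
  simp only [push, h, Finset.sum_filter]
  simp only [← Finset.sum_filter (fun i : Fin l.card => g.1 i.succ = j.succ)]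
  rw [Finset.sum_comm]
  refine Finset.sum_congr rfl fun i _ => ?_
  rcases Fin.eq_zero_or_eq_succ (f.1 i.succ) with h0 | ⟨a, ha⟩
  · rw [h0, g.2, if_neg (Fin.succ_ne_zero j).symm]
    refine (Finset.sum_eq_zero fun b _ => ?_).symm
    rw [if_neg (Fin.succ_ne_zero b).symm]
  · simp only [ha, Fin.succ_inj]
    rw [Finset.sum_ite_eq]
    simp

/-- The Eilenberg–MacLane s-module `HA`: `HA(k₊) = Aᵏ`, with summation over the fibres. -/
def eilenbergMacLane (A : Type) [AddCommMonoid A] : SModule where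
  toFunctor :=
    { obj := fun k => ⟨Fin k.card → A, 0⟩
      map := fun f => ⟨push f, by funext; simp [push]⟩
      map_id := fun _ => Pointed.Hom.ext (funext fun φ => push_id φ)
      map_comp := fun f g => Pointed.Hom.ext (funext fun φ => push_comp f g φ) }
  subsingleton_zero := (inferInstance : Subsingleton (Fin 0 → A))

theorem sum_abs_push_le {k l : GammaOp} (f : k ⟶ l) (φ : Fin k.card → ℝ) :
    ∑ j, |push f φ j| ≤ ∑ i, |φ i| := by
  calc ∑ j, |push f φ j| ≤ ∑ j, ∑ i with f.1 i.succ = j.succ, |φ i| :=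
        Finset.sum_le_sum fun j _ => Finset.abs_sum_le_sum_abs _ _
    _ = ∑ i, ∑ j : Fin l.card, if f.1 i.succ = j.succ then |φ i| else 0 := by
        simp only [Finset.sum_filter]
        rw [Finset.sum_comm]
    _ ≤ ∑ i, |φ i| := by
        refine Finset.sum_le_sum fun i _ => ?_
        rcases Fin.eq_zero_or_eq_succ (f.1 i.succ) with h0 | ⟨a, ha⟩
        · rw [Finset.sum_eq_zero fun b _ => ?_]
          · exact abs_nonneg _
          · rw [h0, if_neg (Fin.succ_ne_zero b).symm]
        · simp only [ha, Fin.succ_inj]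
          rw [Finset.sum_ite_eq]
          simp

/-- The sub-s-module `‖Hℝ‖_r` of `Hℝ`, for `r > 0`: the tuples `φ ∈ ℝᵏ` with `∑ |φ i| < r`. -/
def normHR (r : ℝ) (hr : 0 < r) : SModule where
  toFunctor :=
    { obj := fun k => ⟨{φ : Fin k.card → ℝ // ∑ i, |φ i| < r}, ⟨0, by simpa using hr⟩⟩
      map := fun f => ⟨fun φ => ⟨push f φ.1, (sum_abs_push_le f φ.1).trans_lt φ.2⟩,
        Subtype.ext (by funext; simp [push])⟩
      map_id := fun _ => Pointed.Hom.ext (funext fun φ => Subtype.ext (push_id φ.1))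
      map_comp := fun f g => Pointed.Hom.ext (funext fun φ => Subtype.ext (push_comp f g φ.1)) }
  subsingleton_zero :=
    (inferInstance : Subsingleton {φ : Fin 0 → ℝ // ∑ i, |φ i| < r})

/-- The inclusion `‖Hℝ‖_r → Hℝ`. -/
def normHRIncl (r : ℝ) (hr : 0 < r) :
    (normHR r hr).toFunctor ⟶ (eilenbergMacLane ℝ).toFunctor where
  app _ := ⟨Subtype.val, rfl⟩
  naturality _ _ _ := rfl

end SModule

namespace SingularHomology

/-- The free real vector space functor. -/
noncomputable def realFree : Type u ⥤ ModuleCat.{u} ℝ where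
  obj S := ModuleCat.of ℝ (S →₀ ℝ)
  map f := ModuleCat.ofHom (Finsupp.lmapDomain ℝ ℝ f)
  map_id S := by
    ext : 1
    exact Finsupp.lmapDomain_id ℝ ℝ
  map_comp f g := by
    ext : 1
    exact Finsupp.lmapDomain_comp ℝ ℝ f g

/-- The free real chain complex of a simplicial set `K`: `Cₙ` has basis `Kₙ`, with differential the
alternating sum of the faces. -/
noncomputable def chains (K : SSet.{u}) : ChainComplex (ModuleCat.{u} ℝ) ℕ :=
  (AlgebraicTopology.alternatingFaceMapComplex (ModuleCat.{u} ℝ)).obj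
    (((SimplicialObject.whiskering _ _).obj realFree).obj K)

/-- Regard a finitely supported function on the `n`-simplices as an `n`-chain; `Cₙ` is by definition
the space of these functions. -/
noncomputable def toChain (K : SSet.{u}) (n : ℕ) (c : K.obj (op (.mk n)) →₀ ℝ) :
    (chains K).X n := c

/-- The chain `c` is a cycle. -/
def IsCycle (K : SSet.{u}) (n : ℕ) (c : K.obj (op (.mk n)) →₀ ℝ) : Prop :=
  ∀ m : ℕ, (chains K).d n m (toChain K n c) = 0

/-- The homology class of a cycle. -/
noncomputable def homologyClass (K : SSet.{u}) (n : ℕ) (c : K.obj (op (.mk n)) →₀ ℝ)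
    (hc : IsCycle K n c) : (chains K).homology n :=
  (chains K).homologyπ n ((chains K).cyclesMk (toChain K n c) _ rfl (hc _))

/-- The `ℓ¹`-norm of a chain with respect to the basis of simplices. -/
noncomputable def chainNorm {K : SSet.{u}} {n : ℕ} (c : K.obj (op (.mk n)) →₀ ℝ) : ℝ :=
  c.sum fun _ a => |a|

theorem sum_zsmul_apply {M N : ModuleCat.{u} ℝ} {m : ℕ} (f : Fin m → (M ⟶ N)) (x : M) :
    (∑ j : Fin m, (-1 : ℤ) ^ (j : ℕ) • f j) x = ∑ j : Fin m, (-1 : ℝ) ^ (j : ℕ) • (f j) x := by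
  refine (LinearMap.congr_fun (ModuleCat.hom_sum
    (fun j : Fin m => (-1 : ℤ) ^ (j : ℕ) • f j) Finset.univ) x).trans ?_
  rw [LinearMap.sum_apply]
  refine Finset.sum_congr rfl fun j _ => ?_
  rw [ModuleCat.hom_zsmul, LinearMap.smul_apply, ← Int.cast_smul_eq_zsmul ℝ]
  push_cast
  rfl

/-- The boundary as alternating sum of the faces. -/
theorem d_toChain (K : SSet.{u}) (n : ℕ) (c : K.obj (op (.mk (n + 1))) →₀ ℝ) :
    (chains K).d (n + 1) n (toChain K (n + 1) c) =
      toChain K n (∑ j : Fin (n + 2), (-1 : ℝ) ^ (j : ℕ) • c.mapDomain (SimplicialObject.δ K j)) := by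
  have h : (chains K).d (n + 1) n = ∑ j : Fin (n + 2), (-1 : ℤ) ^ (j : ℕ) •
      (((SimplicialObject.whiskering _ _).obj realFree).obj K).δ j :=
    AlgebraicTopology.AlternatingFaceMapComplex.obj_d_eq _ n
  refine (congrArg (fun φ : (chains K).X (n + 1) ⟶ (chains K).X n =>
    φ (toChain K (n + 1) c)) h).trans ?_
  exact sum_zsmul_apply
    (fun j => (((SimplicialObject.whiskering _ _).obj realFree).obj K).δ j) _

theorem homologyClass_eq (K : SSet.{u}) (n : ℕ) (c c' : K.obj (op (.mk n)) →₀ ℝ)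
    (hc : IsCycle K n c) (hc' : IsCycle K n c') (b : (chains K).X (n + 1))
    (h : (chains K).d (n + 1) n b = toChain K n c - toChain K n c') :
    homologyClass K n c hc = homologyClass K n c' hc' := by
  rw [← sub_eq_zero]
  unfold homologyClass
  rw [← map_sub]
  have hz : (chains K).cyclesMk (toChain K n c) _ rfl (hc _) -
      (chains K).cyclesMk (toChain K n c') _ rfl (hc' _) = (chains K).toCycles (n + 1) n b := by
    apply (ModuleCat.mono_iff_injective ((chains K).iCycles n)).1 inferInstance
    rw [map_sub, ← ModuleCat.comp_apply, HomologicalComplex.toCycles_i, h]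
    exact congrArg₂ (· - ·) ((chains K).i_cyclesMk _ _ _ _) ((chains K).i_cyclesMk _ _ _ _)
  erw [hz]
  rw [← ModuleCat.comp_apply, HomologicalComplex.toCycles_comp_homologyπ]
  rfl

/-- The real singular homology `Hₙ(X; ℝ)`. -/
noncomputable abbrev H (X : TopCat.{u}) (n : ℕ) : ModuleCat.{u} ℝ :=
  (chains (TopCat.toSSet.obj X)).homology n

/-- Gromov's `ℓ¹`-semi-norm on `Hₙ(X; ℝ)`. -/
noncomputable def l1Seminorm (X : TopCat.{u}) (n : ℕ) (α : H X n) : ℝ :=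
  sInf {r : ℝ | ∃ (c : (TopCat.toSSet.obj X).obj (op (.mk n)) →₀ ℝ)
    (hc : IsCycle (TopCat.toSSet.obj X) n c),
    homologyClass (TopCat.toSSet.obj X) n c hc = α ∧ chainNorm c = r}

end SingularHomology

namespace SModule

open SingularHomology PointedSimplicial

/-- The chain `∑ φ i • y i` (terms with `y i` the base point being dropped) given by a pointed map
`y : k₊ → S₊` and `φ ∈ ℝᵏ`. -/
noncomputable def preToFree (S : Type u) (p : (eilenbergMacLane ℝ).Pre (typeToPointed.obj S)) :
    S →₀ ℝ :=
  ∑ i : Fin p.k.card,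
    Option.elim (α := S) (p.pt i.succ) 0 (fun s => Finsupp.single s ((p.coeff : Fin p.k.card → ℝ) i))

/-- The canonical identification of `Hℝ(S₊)` with the real vector space with basis `S`. -/
noncomputable def extToFree (S : Type u) :
    ((eilenbergMacLane ℝ).ext.obj (typeToPointed.obj S)).X → (S →₀ ℝ) :=
  Quot.lift (preToFree S) (by
    rintro _ _ ⟨f, y, hy, x⟩
    show ∑ i, _ = ∑ j, _
    have hs : ∀ j, Option.elim (α := S) (y j.succ) 0
        (fun s => Finsupp.single s (push f (x : Fin _ → ℝ) j)) =
        ∑ i, if f.1 i.succ = j.succ then Option.elim (α := S) (y j.succ) 0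
          (fun s => Finsupp.single s ((x : Fin _ → ℝ) i)) else 0 := by
      intro j
      rw [← Finset.sum_filter]
      cases h : (y j.succ : Option S) with
      | none => simp
      | some s =>
        simp only [Option.elim_some, push]
        exact map_sum (Finsupp.singleAddHom s) _ _
    refine Eq.trans ?_ (Finset.sum_congr rfl fun j _ => (hs j).symm)
    rw [Finset.sum_comm]
    refine Finset.sum_congr rfl fun i _ => ?_
    rcases Fin.eq_zero_or_eq_succ (f.1 i.succ) with h0 | ⟨a, ha⟩
    · rw [Finset.sum_eq_zero fun b _ => ?_]
      · have : (y (f.1 i.succ) : Option S) = none := by rw [h0]; exact hy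
        simp [this]
      · rw [h0, if_neg (Fin.succ_ne_zero b).symm]
    · simp only [ha, Fin.succ_inj, Function.comp_apply]
      rw [Finset.sum_ite_eq]
      simp)

theorem extToFree_point (S : Type u) :
    extToFree S ((eilenbergMacLane ℝ).ext.obj (typeToPointed.obj S)).point = 0 := by
  show preToFree S _ = 0
  exact Finset.sum_eq_zero fun (i : Fin 0) _ => i.elim0

theorem extToFree_map {S T : Type u} (g : S ⟶ T)
    (x : ((eilenbergMacLane ℝ).ext.obj (typeToPointed.obj S)).X) :
    extToFree T (((eilenbergMacLane ℝ).ext.map (typeToPointed.map g)).toFun x) =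
      (extToFree S x).mapDomain g := by
  induction x using Quot.ind with
  | mk p =>
    show preToFree T _ = Finsupp.mapDomain g (preToFree S p)
    unfold preToFree
    rw [Finsupp.mapDomain_finsetSum]
    refine Finset.sum_congr rfl fun i _ => ?_
    show Option.elim (Option.map g (p.pt i.succ)) _ _ = _
    cases h : (p.pt i.succ : Option S) with
    | none => simp
    | some s => simp

theorem extToFree_δ (K : SSet.{u}) (n : ℕ) (j : Fin (n + 2))
    (x : (((eilenbergMacLane ℝ).onSSet K).obj (op (.mk (n + 1)))).X) :
    (extToFree (K.obj (op (.mk (n + 1)))) x).mapDomain (SimplicialObject.δ K j) =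
      extToFree (K.obj (op (.mk n))) ((((eilenbergMacLane ℝ).onSSet K).δ j).toFun x) :=
  (extToFree_map (SimplicialObject.δ K j) x).symm

theorem isCycle_of_isSpherical (K : SSet.{u}) : ∀ (n : ℕ)
    (x : (((eilenbergMacLane ℝ).onSSet K).obj (op (.mk n))).X),
    IsSpherical ((eilenbergMacLane ℝ).onSSet K) n x →
      IsCycle K n (extToFree (K.obj (op (.mk n))) x) := by
  intro n x hx m
  by_cases h : m + 1 = n
  · subst h
    rw [d_toChain, Finset.sum_eq_zero]
    · rfl
    · intro j _
      rw [extToFree_δ, hx j]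
      erw [extToFree_point]
      simp
  · rw [(chains K).shape n m h]
    rfl

/-- The canonical map `Hₙ(K; Hℝ) → Hₙ(K; ℝ)`, sending a spherical simplex of `Hℝ ∘ K₊` to the class
of the corresponding cycle. -/
noncomputable def homologyHRTo (K : SSet.{u}) (n : ℕ) :
    (eilenbergMacLane ℝ).homology K n → (chains K).homology n :=
  Quot.lift (fun x => homologyClass K n (extToFree _ x.1) (isCycle_of_isSpherical K n x.1 x.2)) (by
    rintro x y ⟨z, h0, h1, h2⟩
    have hsq : ((-1 : ℝ) ^ n) * (-1) ^ n = 1 := by rw [← mul_pow]; simp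
    refine homologyClass_eq K n _ _ _ _ (toChain K (n + 1) ((-1 : ℝ) ^ n • extToFree _ z)) ?_
    rw [d_toChain, Fin.sum_univ_castSucc, Fin.sum_univ_castSucc, Finset.sum_eq_zero]
    · simp only [Finsupp.mapDomain_smul]
      rw [extToFree_δ, extToFree_δ, h1, h2, smul_smul, smul_smul]
      simp only [Fin.val_castSucc, Fin.val_last, pow_succ, zero_add]
      rw [mul_right_comm, hsq, one_smul, one_mul, neg_one_smul, ← sub_eq_add_neg]
      rfl
    · intro j _
      rw [Finsupp.mapDomain_smul, extToFree_δ, h0 _ j.2]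
      erw [extToFree_point]
      simp)

/-- The canonical map `Hₙ(X; ‖Hℝ‖_r) → Hₙ(X; ℝ)` for a topological space `X`. -/
noncomputable def rho (X : TopCat.{u}) (n : ℕ) (r : ℝ) (hr : 0 < r) :
    (normHR r hr).homology (TopCat.toSSet.obj X) n → H X n :=
  fun x => homologyHRTo (TopCat.toSSet.obj X) n
    (homologyMap (normHRIncl r hr) (TopCat.toSSet.obj X) n x)

/-- The Connes–Consani semi-norm on `Hₙ(X; ℝ)`, defined by the filtration by the images of the
`Hₙ(X; ‖Hℝ‖_r)`. -/
noncomputable def ccSeminorm (X : TopCat.{u}) (n : ℕ) (α : H X n) : ℝ :=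
  sInf {r : ℝ | ∃ hr : 0 < r, α ∈ Set.range (rho X n r hr)}

end SModule

/-!
A permutation `τ` of the vertices acts on the singular simplices of `X`, and averaging `sign τ • τ`
gives an antisymmetrization operator on chains which does not increase the `ℓ¹`-norm. It is chain
homotopic to the identity by acyclic models: both are natural for all maps of the vertices, so it
suffices to work in the linearization of the category of all maps `{0, …, m} → {0, …, n}`, where
coning off with a vertex is a contraction. The `j`-th face of an antisymmetric chain is `(-1) ^ j`
times its `0`-th face, so all faces of an antisymmetric *cycle* vanish individually. On the other
hand, `‖Hℝ‖_r(S₊)` is the open ball of radius `r` in the `ℓ¹`-space with basis `S`, so that the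
spherical simplices of `‖Hℝ‖_r ∘ K₊` are the chains of norm `< r` all of whose faces vanish.
-/

/-! ### The universal chain complex and antisymmetrization -/

/-- The category of the nonempty finite sets `{0, …, n}` and *all* maps between them, of which
`SimplexCategory` is the subcategory of monotone maps. -/
structure SymmSimplex : Type where
  len : ℕ

namespace SymmSimplex

instance : Category SymmSimplex where
  Hom m n := Fin (m.len + 1) → Fin (n.len + 1)
  id _ := id
  comp f g := g ∘ f

/-- A map `{0, …, m} → {0, …, n}` as a morphism. -/
abbrev homMk {m n : ℕ} (f : Fin (m + 1) → Fin (n + 1)) : SymmSimplex.mk m ⟶ ⟨n⟩ := f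

/-- The inclusion of the simplex category. -/
def ofSimplex : SimplexCategory ⥤ SymmSimplex where
  obj n := ⟨n.len⟩
  map f := f.toOrderHom

section FreeComplex

variable (R : Type*) [CommRing R]

/-- The universal chain complex of a symmetric simplicial object: the alternating face map complex
of the simplicial object `[n] ↦ [n]` of the `R`-linear category generated by `SymmSimplexᵒᵖ`. -/
noncomputable def freeComplex : ChainComplex (Free R SymmSimplexᵒᵖ) ℕ :=
  (AlgebraicTopology.alternatingFaceMapComplex _).obj (ofSimplex.op ⋙ Free.embedding R _)

variable {R}

/-- A map `{0, …, m} → {0, …, n}`, as an operation from degree `n` to degree `m`. -/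
noncomputable def of {m n : ℕ} (f : Fin (m + 1) → Fin (n + 1)) :
    (freeComplex R).X n ⟶ (freeComplex R).X m :=
  Finsupp.single (homMk f).op 1

theorem of_id (n : ℕ) : of id = 𝟙 ((freeComplex R).X n) := rfl

theorem of_comp_of {l m n : ℕ} (f : Fin (m + 1) → Fin (n + 1)) (g : Fin (l + 1) → Fin (m + 1)) :
    of (R := R) f ≫ of g = of (f ∘ g) :=
  (Free.single_comp_single ..).trans <| by rw [one_mul]; rfl

theorem freeComplex_d (n : ℕ) :
    (freeComplex R).d (n + 1) n = ∑ j : Fin (n + 2), (-1 : ℤ) ^ (j : ℕ) • of j.succAbove :=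
  AlgebraicTopology.AlternatingFaceMapComplex.obj_d_eq _ n

theorem linearMap_ext {m n : ℕ} {M : Type*} [AddCommMonoid M] [Module R M]
    {φ ψ : ((freeComplex R).X n ⟶ (freeComplex R).X m) →ₗ[R] M}
    (h : ∀ f : Fin (m + 1) → Fin (n + 1), φ (of f) = ψ (of f)) : φ = ψ :=
  Finsupp.lhom_ext' fun f => LinearMap.ext_ring (h f.unop)

/-- The cone with apex the vertex `0`. -/
noncomputable def cone {m n : ℕ} : ((freeComplex R).X n ⟶ (freeComplex R).X m) →ₗ[R]
    ((freeComplex R).X n ⟶ (freeComplex R).X (m + 1)) :=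
  Finsupp.lmapDomain R R fun f => (homMk (m := m + 1) (n := n) (Fin.cons 0 f.unop)).op

theorem cone_of {m n : ℕ} (f : Fin (m + 1) → Fin (n + 1)) :
    cone (of (R := R) f) = of (Fin.cons 0 f : Fin (m + 2) → Fin (n + 1)) :=
  Finsupp.mapDomain_single

theorem cone_of_comp_d {m n : ℕ} (f : Fin (m + 2) → Fin (n + 1)) :
    cone (of (R := R) f) ≫ (freeComplex R).d (m + 2) (m + 1) =
      of f - cone (of f ≫ (freeComplex R).d (m + 1) m) := by
  have hface (j : Fin (m + 2)) : (Fin.cons 0 f : Fin (m + 3) → Fin (n + 1)) ∘ j.succ.succAbove =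
      (Fin.cons 0 (f ∘ j.succAbove) : Fin (m + 2) → Fin (n + 1)) := by
    funext i
    cases i using Fin.cases <;> simp
  have hzero : (Fin.cons 0 f : Fin (m + 3) → Fin (n + 1)) ∘ (0 : Fin (m + 3)).succAbove = f := rfl
  simp only [freeComplex_d, Fin.sum_univ_succ (n := m + 2), Preadditive.comp_sum,
    Preadditive.comp_add, Preadditive.comp_neg, Preadditive.comp_zsmul, of_comp_of, cone_of,
    map_sum, map_zsmul, hface, hzero, Fin.val_zero, Fin.val_succ, pow_succ, pow_zero, one_smul,
    mul_neg_one, neg_smul, Finset.sum_neg_distrib, sub_eq_add_neg]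

theorem cone_comp_d {m n : ℕ} (φ : (freeComplex R).X n ⟶ (freeComplex R).X (m + 1)) :
    cone φ ≫ (freeComplex R).d (m + 2) (m + 1) = φ - cone (φ ≫ (freeComplex R).d (m + 1) m) := by
  revert φ
  refine LinearMap.congr_fun (f := Linear.rightComp R _ ((freeComplex R).d _ _) ∘ₗ cone)
    (g := LinearMap.id - cone ∘ₗ Linear.rightComp R _ ((freeComplex R).d _ _))
    (linearMap_ext fun f => ?_)
  exact cone_of_comp_d f

theorem cone_comp_d_of_comp_d_eq_zero {m n : ℕ}
    {φ : (freeComplex R).X n ⟶ (freeComplex R).X (m + 1)}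
    (hφ : φ ≫ (freeComplex R).d (m + 1) m = 0) :
    cone φ ≫ (freeComplex R).d (m + 2) (m + 1) = φ := by
  rw [cone_comp_d, hφ, map_zero, sub_zero]

/-- Since a cycle of positive degree bounds the cone over it, a chain endomorphism which vanishes in
degree `0` is null-homotopic. -/
noncomputable def homotopyZero (φ : freeComplex R ⟶ freeComplex R) (h : φ.f 0 = 0) :
    Homotopy φ 0 :=
  Homotopy.mkInductive φ 0 (by rw [h, Limits.zero_comp]) (cone (φ.f 1))
    (by rw [Limits.comp_zero, zero_add, cone_comp_d_of_comp_d_eq_zero]; simp [h])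
    fun n ⟨f, f', hf⟩ => ⟨cone (φ.f (n + 2) - (freeComplex R).d _ _ ≫ f'), by
      have hd := congrArg ((freeComplex R).d (n + 2) (n + 1) ≫ ·) hf
      rw [cone_comp_d_of_comp_d_eq_zero, add_sub_cancel]
      simpa [sub_eq_zero] using hd⟩

/-- Acyclic models: chain endomorphisms of the universal complex agreeing in degree `0` are
chain homotopic. -/
noncomputable def homotopyOfEqZero {φ ψ : freeComplex R ⟶ freeComplex R} (h : φ.f 0 = ψ.f 0) :
    Homotopy φ ψ :=
  Homotopy.equivSubZero.symm (homotopyZero (φ - ψ) (by simp [h]))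

end FreeComplex

section SignedSum

variable (R : Type*) [CommRing R]

/-- The signed sum of the permutations of the vertices. -/
noncomputable def signedSum (n : ℕ) : (freeComplex R).X n ⟶ (freeComplex R).X n :=
  ∑ τ : Equiv.Perm (Fin (n + 1)), (Equiv.Perm.sign τ : ℤ) • of τ

variable {R}

theorem signedSum_comp_of_succAbove {n : ℕ} (j : Fin (n + 2)) :
    signedSum R (n + 1) ≫ of j.succAbove =
      (-1 : ℤ) ^ (j : ℕ) • signedSum R (n + 1) ≫ of Fin.succ := by
  simp only [signedSum, Preadditive.sum_comp, Preadditive.zsmul_comp, of_comp_of, Finset.smul_sum,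
    smul_smul]
  refine Fintype.sum_equiv (Equiv.mulRight j.cycleRange.symm) _ _ fun τ => ?_
  have hτ : ⇑τ ∘ j.succAbove = ⇑(τ * j.cycleRange.symm) ∘ Fin.succ := by
    funext i
    simp
  rw [hτ, Equiv.coe_mulRight, Equiv.Perm.sign_mul, Equiv.Perm.sign_symm, Fin.sign_cycleRange]
  push_cast
  rw [mul_left_comm, ← mul_pow, neg_one_mul, neg_neg, one_pow, mul_one]

theorem signedSum_comp_d (n : ℕ) :
    signedSum R (n + 1) ≫ (freeComplex R).d (n + 1) n =
      (n + 2) • signedSum R (n + 1) ≫ of Fin.succ := by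
  simp [freeComplex_d, Preadditive.comp_sum, signedSum_comp_of_succAbove, smul_smul, ← mul_pow]

theorem bijective_cycleRange_symm_mul_decomposeFin_symm (n : ℕ) :
    Function.Bijective fun p : Fin (n + 1) × Equiv.Perm (Fin n) =>
      p.1.cycleRange.symm * Equiv.Perm.decomposeFin.symm (0, p.2) := by
  refine (Fintype.bijective_iff_injective_and_card _).2
    ⟨?_, by simp [Fintype.card_perm, Nat.factorial_succ]⟩
  rintro ⟨i, σ⟩ ⟨j, τ⟩ h
  obtain rfl : i = j := by simpa using Equiv.congr_fun h 0
  simpa using h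

/-- A permutation `τ` of `{0, …, n}` amounts to the image `j` of `0` together with the permutation
`σ` of `{0, …, n - 1}` such that `τ ∘ succ = j.succAbove ∘ σ`. -/
noncomputable def permEquiv (n : ℕ) :
    Fin (n + 1) × Equiv.Perm (Fin n) ≃ Equiv.Perm (Fin (n + 1)) :=
  .ofBijective _ (bijective_cycleRange_symm_mul_decomposeFin_symm n)

theorem permEquiv_comp_succ {n : ℕ} (j : Fin (n + 1)) (σ : Equiv.Perm (Fin n)) :
    permEquiv n (j, σ) ∘ Fin.succ = j.succAbove ∘ σ := by
  funext i
  simp [permEquiv]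

theorem sign_permEquiv {n : ℕ} (j : Fin (n + 1)) (σ : Equiv.Perm (Fin n)) :
    Equiv.Perm.sign (permEquiv n (j, σ)) = (-1) ^ (j : ℕ) * Equiv.Perm.sign σ := by
  simp [permEquiv]

theorem d_comp_signedSum (n : ℕ) :
    (freeComplex R).d (n + 1) n ≫ signedSum R n = signedSum R (n + 1) ≫ of Fin.succ := by
  rw [freeComplex_d, Preadditive.sum_comp]
  simp only [signedSum, Preadditive.comp_sum, Preadditive.sum_comp, Preadditive.zsmul_comp,
    Preadditive.comp_zsmul, of_comp_of, smul_smul]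
  rw [← Fintype.sum_prod_type']
  refine Fintype.sum_equiv (permEquiv (n + 1)) _ _ fun ⟨j, σ⟩ => ?_
  simp [permEquiv_comp_succ, sign_permEquiv, mul_comm]

end SignedSum

section Alt

variable (k : Type*) [Field k]

/-- Antisymmetrization in degree `n`. -/
noncomputable def alt (n : ℕ) : (freeComplex k).X n ⟶ (freeComplex k).X n :=
  ((n + 1).factorial : k)⁻¹ • signedSum k n

theorem alt_zero : alt k 0 = 𝟙 _ := by
  have : Subsingleton (Fin (0 + 1)) := inferInstanceAs (Subsingleton (Fin 1))
  simp only [alt, signedSum, Fintype.sum_unique]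
  simp [← of_id]

theorem nsmul_alt_comp_of_succAbove {n : ℕ} (j : Fin (n + 2)) :
    (n + 2) • alt k (n + 1) ≫ of j.succAbove =
      (-1 : ℤ) ^ (j : ℕ) • alt k (n + 1) ≫ (freeComplex k).d (n + 1) n := by
  simp only [alt, Linear.smul_comp, signedSum_comp_of_succAbove, signedSum_comp_d]
  module

variable [CharZero k]

theorem alt_comp_d (n : ℕ) : alt k (n + 1) ≫ (freeComplex k).d (n + 1) n =
    (freeComplex k).d (n + 1) n ≫ alt k n := by
  have : ((n + 2 : ℕ) : k) ≠ 0 := Nat.cast_ne_zero.2 (by simp)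
  rw [alt, alt, Linear.smul_comp, Linear.comp_smul, signedSum_comp_d, d_comp_signedSum,
    ← Nat.cast_smul_eq_nsmul k, smul_smul, Nat.factorial_succ (n + 1), Nat.cast_mul,
    mul_inv_rev, inv_mul_cancel_right₀ this]

/-- Antisymmetrization, as a chain endomorphism of the universal complex. -/
noncomputable def altHom : freeComplex k ⟶ freeComplex k where
  f := alt k
  comm' := by
    rintro _ n rfl
    exact alt_comp_d k n

/-- The homotopy by which a cycle is homologous to its antisymmetrization. -/
noncomputable def altHomotopy : Homotopy (altHom k) (𝟙 (freeComplex k)) :=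
  homotopyOfEqZero (alt_zero k)

end Alt

end SymmSimplex

/-! ### Antisymmetrization of cycles -/

section L1Norm

variable {S T : Type*}

/-- The `ℓ¹`-norm on the real vector space with basis `S`; `SingularHomology.chainNorm` is the case
of a set of simplices. -/
noncomputable def l1Norm (S : Type*) : Seminorm ℝ (S →₀ ℝ) :=
  .of (fun c => c.sum fun _ a => |a|)
    (fun c d => by
      classical
      rw [Finsupp.sum_of_support_subset (c + d) Finsupp.support_add _ (by simp),
        Finsupp.sum_of_support_subset c Finset.subset_union_left _ (by simp),
        Finsupp.sum_of_support_subset d Finset.subset_union_right _ (by simp),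
        ← Finset.sum_add_distrib]
      exact Finset.sum_le_sum fun s _ => abs_add_le _ _)
    (fun r c => by
      rw [Finsupp.sum_smul_index (by simp), Finsupp.mul_sum]
      simp only [abs_mul, Real.norm_eq_abs])

theorem l1Norm_single (s : S) (a : ℝ) : l1Norm S (.single s a) = |a| :=
  Finsupp.sum_single_index abs_zero

theorem l1Norm_sum_le {ι : Type*} (t : Finset ι) (c : ι → S →₀ ℝ) :
    l1Norm S (∑ i ∈ t, c i) ≤ ∑ i ∈ t, l1Norm S (c i) :=
  Finset.le_sum_of_subadditive _ (map_zero (l1Norm S)).le (map_add_le_add _) t c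

theorem l1Norm_mapDomain_le (f : S → T) (c : S →₀ ℝ) : l1Norm T (c.mapDomain f) ≤ l1Norm S c :=
  (l1Norm_sum_le _ _).trans_eq (Finset.sum_congr rfl fun s _ => l1Norm_single (f s) (c s))

end L1Norm

namespace SingularHomology

theorem homologyClass_surjective (K : SSet.{u}) (n : ℕ) (α : (chains K).homology n) :
    ∃ c hc, homologyClass K n c hc = α := by
  obtain ⟨z, rfl⟩ := (ModuleCat.epi_iff_surjective ((chains K).homologyπ n)).1 inferInstance α
  have hz (m : ℕ) : (chains K).d n m ((chains K).iCycles n z) = 0 := by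
    rw [← ModuleCat.comp_apply, HomologicalComplex.iCycles_d]
    rfl
  refine ⟨(chains K).iCycles n z, hz, congrArg ((chains K).homologyπ n) ?_⟩
  apply (ModuleCat.mono_iff_injective ((chains K).iCycles n)).1 inferInstance
  exact (chains K).i_cyclesMk _ _ _ _

theorem l1Seminorm_lt_iff {X : TopCat.{u}} {n : ℕ} {α : H X n} {r : ℝ} :
    l1Seminorm X n α < r ↔
      ∃ c hc, homologyClass (TopCat.toSSet.obj X) n c hc = α ∧ chainNorm c < r := by
  obtain ⟨c₀, hc₀, hα⟩ := homologyClass_surjective _ n α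
  refine (csInf_lt_iff ⟨0, ?_⟩ (by exact ⟨_, c₀, hc₀, hα, rfl⟩)).trans ⟨?_, ?_⟩
  · rintro _ ⟨c, _, _, rfl⟩
    exact apply_nonneg (l1Norm _) c
  · rintro ⟨_, ⟨c, hc, hα, rfl⟩, hr⟩
    exact ⟨c, hc, hα, hr⟩
  · rintro ⟨c, hc, hα, hr⟩
    exact ⟨_, ⟨c, hc, hα, rfl⟩, hr⟩

theorem l1Seminorm_nonneg (X : TopCat.{u}) (n : ℕ) (α : H X n) : 0 ≤ l1Seminorm X n α := by
  refine Real.sInf_nonneg ?_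
  rintro _ ⟨c, _, _, rfl⟩
  exact apply_nonneg (l1Norm _) c

/-- All faces of the chain `c` vanish individually, which is the condition of being spherical for a
simplex of `Hℝ ∘ K₊`. -/
def HasZeroFaces (K : SSet.{u}) : (n : ℕ) → (K.obj (op (.mk n)) →₀ ℝ) → Prop
  | 0, _ => True
  | n + 1, c => ∀ j : Fin (n + 2), c.mapDomain (SimplicialObject.δ K j) = 0

theorem HasZeroFaces.isCycle {K : SSet.{u}} {n : ℕ} {c : K.obj (op (.mk n)) →₀ ℝ}
    (h : HasZeroFaces K n c) : IsCycle K n c := by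
  intro m
  by_cases hm : m + 1 = n
  · subst hm
    rw [d_toChain, Finset.sum_eq_zero fun j _ => by rw [h j, smul_zero]]
    rfl
  · rw [(chains K).shape n m hm]
    rfl

end SingularHomology

namespace SymmSimplex

open SingularHomology

section Realization

variable (K : SymmSimplexᵒᵖ ⥤ Type u)

/-- The action of a morphism of the universal complex on the chains of `K`, by linear extension of
the action of the maps `{0, …, m} → {0, …, n}` on the simplices of `K`. -/
noncomputable def act {m n : ℕ} : ((freeComplex ℝ).X n ⟶ (freeComplex ℝ).X m) →ₗ[ℝ]
    (K.obj (op ⟨n⟩) →₀ ℝ) →ₗ[ℝ] (K.obj (op ⟨m⟩) →₀ ℝ) :=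
  Finsupp.linearCombination ℝ fun f => Finsupp.lmapDomain ℝ ℝ (K.map f)

theorem act_of {m n : ℕ} (f : Fin (m + 1) → Fin (n + 1)) :
    act K (of f) = Finsupp.lmapDomain ℝ ℝ (K.map (homMk f).op) :=
  (Finsupp.linearCombination_single ..).trans (one_smul ℝ _)

theorem act_id (n : ℕ) : act K (𝟙 ((freeComplex ℝ).X n)) = LinearMap.id := by
  rw [← of_id, act_of]
  exact (congrArg (fun f : _ ⟶ _ => Finsupp.lmapDomain ℝ ℝ f) (K.map_id (op ⟨n⟩))).trans
    (Finsupp.lmapDomain_id ℝ ℝ)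

theorem act_comp {l m n : ℕ} (φ : (freeComplex ℝ).X n ⟶ (freeComplex ℝ).X m)
    (ψ : (freeComplex ℝ).X m ⟶ (freeComplex ℝ).X l) :
    act K (φ ≫ ψ) = act K ψ ∘ₗ act K φ := by
  revert φ
  refine LinearMap.congr_fun (f := act K ∘ₗ Linear.rightComp ℝ _ ψ)
    (g := LinearMap.compRight ℝ (act K ψ) ∘ₗ act K)
    (linearMap_ext fun f => ?_)
  revert ψ
  refine LinearMap.congr_fun (f := act K ∘ₗ Linear.leftComp ℝ _ (of f))
    (g := LinearMap.lcomp ℝ _ (act K (of f)) ∘ₗ act K) (linearMap_ext fun g => ?_)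
  change act K (of f ≫ of g) = act K (of g) ∘ₗ act K (of f)
  rw [of_comp_of, act_of, act_of, act_of, ← Finsupp.lmapDomain_comp]
  exact congrArg (fun h : _ ⟶ _ => Finsupp.lmapDomain ℝ ℝ h)
    (K.map_comp (homMk f).op (homMk g).op)

theorem chains_d_toChain (m n : ℕ) (c : K.obj (op ⟨n⟩) →₀ ℝ) :
    (chains (ofSimplex.op ⋙ K)).d n m (toChain (ofSimplex.op ⋙ K) n c) =
      toChain (ofSimplex.op ⋙ K) m (act K ((freeComplex ℝ).d n m) c) := by
  by_cases h : m + 1 = n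
  · subst h
    rw [freeComplex_d, map_sum, LinearMap.sum_apply]
    refine (d_toChain (ofSimplex.op ⋙ K) m c).trans (congrArg (toChain _ _) ?_)
    refine Finset.sum_congr rfl fun j _ => ?_
    rw [map_zsmul, act_of, LinearMap.smul_apply, ← Int.cast_smul_eq_zsmul ℝ, Int.cast_pow,
      Int.cast_neg, Int.cast_one]
    rfl
  · rw [(freeComplex ℝ).shape n m h, (chains (ofSimplex.op ⋙ K)).shape n m h, map_zero]
    rfl

variable {K}

theorem isCycle_iff_act_d {n : ℕ} {c : K.obj (op ⟨n⟩) →₀ ℝ} :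
    IsCycle (ofSimplex.op ⋙ K) n c ↔ ∀ m, act K ((freeComplex ℝ).d n m) c = 0 :=
  forall_congr' fun m => by rw [chains_d_toChain]; rfl

theorem hasZeroFaces_act_alt {n : ℕ} {c : K.obj (op ⟨n⟩) →₀ ℝ}
    (hc : ∀ m, act K ((freeComplex ℝ).d n m) c = 0) :
    HasZeroFaces (ofSimplex.op ⋙ K) n (act K (alt ℝ n) c) := by
  cases n with
  | zero => trivial
  | succ n =>
    intro j
    have h : (n + 2) • act K (of j.succAbove) (act K (alt ℝ (n + 1)) c) = 0 := by
      have hj := LinearMap.congr_fun (congrArg (act K) (nsmul_alt_comp_of_succAbove ℝ j)) c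
      rwa [alt_comp_d, map_nsmul, map_zsmul, act_comp, act_comp, LinearMap.smul_apply,
        LinearMap.smul_apply, LinearMap.comp_apply, LinearMap.comp_apply, hc, map_zero,
        smul_zero] at hj
    rw [act_of] at h
    exact (smul_eq_zero_iff_right (by simp)).1 h

theorem act_d_act_altHomotopy {n : ℕ} {c : K.obj (op ⟨n⟩) →₀ ℝ}
    (hc : ∀ m, act K ((freeComplex ℝ).d n m) c = 0) :
    act K ((freeComplex ℝ).d (n + 1) n) (act K ((altHomotopy ℝ).hom n (n + 1)) c) =
      act K (alt ℝ n) c - c := by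
  have h := LinearMap.congr_fun (congrArg (act K) ((altHomotopy ℝ).comm n)) c
  have hnext : act K (dNext n (altHomotopy ℝ).hom) c = 0 := by
    change act K ((freeComplex ℝ).d n _ ≫ _) c = 0
    rw [act_comp, LinearMap.comp_apply, hc, map_zero]
  rw [map_add, map_add, LinearMap.add_apply, LinearMap.add_apply, hnext, zero_add,
    Homotopy.prevD_chainComplex, act_comp, HomologicalComplex.id_f, act_id] at h
  exact (sub_eq_of_eq_add h).symm

theorem chainNorm_act_alt_le {n : ℕ} (c : K.obj (op ⟨n⟩) →₀ ℝ) :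
    chainNorm (K := ofSimplex.op ⋙ K) (act K (alt ℝ n) c) ≤
      chainNorm (K := ofSimplex.op ⋙ K) c := by
  have hf : (0 : ℝ) < (n + 1).factorial := by positivity
  have hτ (τ : Equiv.Perm (Fin (n + 1))) :
      l1Norm _ (act K ((Equiv.Perm.sign τ : ℤ) • of τ) c) ≤ l1Norm _ c := by
    rw [map_zsmul, act_of, LinearMap.smul_apply, ← Int.cast_smul_eq_zsmul ℝ, map_smul_eq_mul,
      Real.norm_eq_abs, ← Int.cast_abs, Int.isUnit_iff_abs_eq.1 (Equiv.Perm.sign τ).isUnit,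
      Int.cast_one, one_mul]
    exact l1Norm_mapDomain_le _ c
  change l1Norm _ (act K (alt ℝ n) c) ≤ l1Norm _ c
  calc l1Norm _ (act K (alt ℝ n) c)
      = ((n + 1).factorial : ℝ)⁻¹ * l1Norm _ (act K (signedSum ℝ n) c) := by
        rw [alt, map_smul, LinearMap.smul_apply, map_smul_eq_mul,
          Real.norm_of_nonneg (by positivity)]
    _ ≤ ((n + 1).factorial : ℝ)⁻¹ * ∑ _τ : Equiv.Perm (Fin (n + 1)), l1Norm _ c := by
        rw [signedSum, map_sum, LinearMap.sum_apply]
        gcongr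
        exact (l1Norm_sum_le _ _).trans (Finset.sum_le_sum fun τ _ => hτ τ)
    _ = l1Norm _ c := by
        rw [Finset.sum_const, Finset.card_univ, Fintype.card_perm, Fintype.card_fin, nsmul_eq_mul,
          inv_mul_cancel_left₀ hf.ne']

theorem exists_hasZeroFaces {n : ℕ} (c : K.obj (op ⟨n⟩) →₀ ℝ)
    (hc : IsCycle (ofSimplex.op ⋙ K) n c) :
    ∃ (c' : K.obj (op ⟨n⟩) →₀ ℝ) (hc' : HasZeroFaces (ofSimplex.op ⋙ K) n c'),
      homologyClass _ n c' hc'.isCycle = homologyClass (ofSimplex.op ⋙ K) n c hc ∧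
        chainNorm (K := ofSimplex.op ⋙ K) c' ≤ chainNorm (K := ofSimplex.op ⋙ K) c := by
  have hd := isCycle_iff_act_d.1 hc
  refine ⟨act K (alt ℝ n) c, hasZeroFaces_act_alt hd, ?_, chainNorm_act_alt_le c⟩
  refine homologyClass_eq _ n _ _ _ _ (toChain _ _ (act K ((altHomotopy ℝ).hom n (n + 1)) c)) ?_
  exact (chains_d_toChain K _ _ _).trans (congrArg (toChain _ _) (act_d_act_altHomotopy hd))

end Realization

/-- The topological simplices, with the affine maps extending arbitrary maps of the vertices. -/
noncomputable def toTop : SymmSimplex ⥤ TopCat.{0} where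
  obj n := TopCat.of (stdSimplex ℝ (Fin (n.len + 1)))
  map f := TopCat.ofHom ⟨stdSimplex.map f, stdSimplex.continuous_map f⟩
  map_id n := by
    ext x : 1
    exact stdSimplex.map_id_apply x
  map_comp f g := by
    ext x : 1
    exact (stdSimplex.map_comp_apply f g x).symm

/-- The singular simplices of a space, as a symmetric simplicial set. By definition
`ofSimplex.op ⋙ sing X` is `TopCat.toSSet.obj X`. -/
noncomputable def sing (X : TopCat.{u}) : SymmSimplexᵒᵖ ⥤ Type u :=
  (Presheaf.restrictedULiftYoneda.{0} (toTop ⋙ TopCat.uliftFunctor.{u})).obj X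

end SymmSimplex

/-! ### The homology of `‖Hℝ‖_r` -/

namespace SModule

open SingularHomology PointedSimplicial

/-- The finite set `T ⊆ S` with a base point, enumerated. -/
noncomputable def enumWithPoint {S : Type u} (T : Finset S) : Fin (T.card + 1) → Option S :=
  Fin.cons none fun i => some (T.equivFin.symm i)

theorem exists_enumWithPoint_eq {S : Type u} {T : Finset S} {s : S} (hs : s ∈ T) :
    ∃ i, enumWithPoint T i = some s :=
  ⟨(T.equivFin ⟨s, hs⟩).succ, by simp [enumWithPoint]⟩

theorem enumWithPoint_injective {S : Type u} (T : Finset S) :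
    Function.Injective (enumWithPoint T) := by
  refine Fin.cons_injective_iff.2 ⟨by simp, fun i j h => ?_⟩
  exact T.equivFin.symm.injective (Subtype.ext (Option.some.inj h))

/-- The map `F(T₊) → F(S₊)` for a finite subset `T` of `S`. -/
noncomputable def ofFinset (F : SModule) {S : Type u} (T : Finset S)
    (ψ : (F.toFunctor.obj ⟨T.card⟩).X) : (F.ext.obj (typeToPointed.obj S)).X :=
  Quot.mk _ ⟨⟨T.card⟩, enumWithPoint T, rfl, ψ⟩

theorem exists_forall_superset_eq_ofFinset (F : SModule) {S : Type u}
    (x : (F.ext.obj (typeToPointed.obj S)).X) :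
    ∃ T : Finset S, ∀ T', T ⊆ T' → ∃ ψ, x = ofFinset F T' ψ := by
  classical
  induction x using Quot.ind with
  | mk p =>
    let q : Fin (p.k.card + 1) → Option S := p.pt
    refine ⟨Finset.eraseNone (Finset.univ.image q), fun T hT => ?_⟩
    have hq (i) : ∃ j, enumWithPoint T j = q i := by
      cases h : q i with
      | none => exact ⟨0, rfl⟩
      | some s => exact exists_enumWithPoint_eq (hT (by simp [← h]))
    choose f hf using hq
    let g : p.k ⟶ (⟨T.card⟩ : GammaOp) :=
      ⟨f, enumWithPoint_injective T ((hf 0).trans p.pt_zero)⟩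
    refine ⟨(F.toFunctor.map g).toFun p.coeff, .trans ?_ (Quot.sound (PreRel.mk g _ rfl p.coeff))⟩
    obtain ⟨k, pt, _, φ⟩ := p
    congr 2
    exact (funext hf).symm

section NormHR

variable (r : ℝ) (hr : 0 < r) (S : Type u)

/-- The chain underlying an element of `‖Hℝ‖_r(S₊)`. -/
noncomputable def normToFree (x : ((normHR r hr).ext.obj (typeToPointed.obj S)).X) : S →₀ ℝ :=
  extToFree S (((extNatTrans (normHRIncl r hr)).app (typeToPointed.obj S)).toFun x)

variable {S}

theorem normToFree_ofFinset (T : Finset S) (φ : {φ : Fin T.card → ℝ // ∑ i, |φ i| < r}) :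
    normToFree r hr S (ofFinset (normHR r hr) T φ) =
      ∑ i, Finsupp.single (T.equivFin.symm i : S) (φ.1 i) :=
  rfl

theorem normToFree_point :
    normToFree r hr S ((normHR r hr).ext.obj (typeToPointed.obj S)).point = 0 := by
  rw [normToFree, Pointed.Hom.map_point, extToFree_point]

theorem normToFree_ofFinset_apply (T : Finset S) (φ : {φ : Fin T.card → ℝ // ∑ i, |φ i| < r})
    (i : Fin T.card) :
    normToFree r hr S (ofFinset (normHR r hr) T φ) (T.equivFin.symm i) = φ.1 i := by
  classical
  simp [normToFree_ofFinset, Finsupp.finsetSum_apply, Finsupp.single_apply]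

theorem normToFree_ofFinset_injective (T : Finset S) :
    Function.Injective fun φ => normToFree r hr S (ofFinset (normHR r hr) T φ) :=
  fun φ ψ h => Subtype.ext <| funext fun i => by
    rw [← normToFree_ofFinset_apply r hr T φ, ← normToFree_ofFinset_apply r hr T ψ]
    exact DFunLike.congr_fun h _

theorem normToFree_injective : Function.Injective (normToFree r hr S) := by
  classical
  intro x y h
  obtain ⟨T₁, hT₁⟩ := exists_forall_superset_eq_ofFinset _ x
  obtain ⟨T₂, hT₂⟩ := exists_forall_superset_eq_ofFinset _ y
  obtain ⟨φ, rfl⟩ := hT₁ (T₁ ∪ T₂) Finset.subset_union_left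
  obtain ⟨ψ, rfl⟩ := hT₂ (T₁ ∪ T₂) Finset.subset_union_right
  exact congrArg _ (normToFree_ofFinset_injective r hr _ h)

theorem l1Norm_normToFree_lt (x : ((normHR r hr).ext.obj (typeToPointed.obj S)).X) :
    l1Norm S (normToFree r hr S x) < r := by
  obtain ⟨T, hT⟩ := exists_forall_superset_eq_ofFinset _ x
  obtain ⟨φ, rfl⟩ := hT T subset_rfl
  calc l1Norm S (∑ i, Finsupp.single (T.equivFin.symm i : S) (φ.1 i))
      ≤ ∑ i, l1Norm S (Finsupp.single (T.equivFin.symm i : S) (φ.1 i)) := l1Norm_sum_le _ _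
    _ = ∑ i, |φ.1 i| := by simp only [l1Norm_single]
    _ < r := φ.2

theorem exists_normToFree_eq {c : S →₀ ℝ} (hc : l1Norm S c < r) :
    ∃ x, normToFree r hr S x = c := by
  have hsum : ∑ i, |c (c.support.equivFin.symm i)| = l1Norm S c := by
    rw [Equiv.sum_comp c.support.equivFin.symm fun s => |c s|,
      Finset.sum_coe_sort c.support fun s => |c s|]
    rfl
  refine ⟨_, (normToFree_ofFinset r hr c.support
    ⟨fun i => c (c.support.equivFin.symm i), hsum.trans_lt hc⟩).trans ?_⟩
  rw [Equiv.sum_comp c.support.equivFin.symm fun s => Finsupp.single (s : S) (c s),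
    Finset.sum_coe_sort c.support fun s => Finsupp.single s (c s)]
  exact c.sum_single

end NormHR

variable {r : ℝ} {hr : 0 < r} {K : SSet.{u}} {n : ℕ}

theorem normToFree_δ (j : Fin (n + 2)) (x : (((normHR r hr).onSSet K).obj (op (.mk (n + 1)))).X) :
    normToFree r hr (K.obj (op (.mk n))) ((((normHR r hr).onSSet K).δ j).toFun x) =
      (normToFree r hr (K.obj (op (.mk (n + 1)))) x).mapDomain (SimplicialObject.δ K j) :=
  (congrArg (extToFree _) (naturality_δ (Functor.whiskerLeft K
    (Functor.whiskerLeft typeToPointed (extNatTrans (normHRIncl r hr)))) j x).symm).trans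
    (extToFree_δ K n j _).symm

theorem isSpherical_iff_hasZeroFaces {x : (((normHR r hr).onSSet K).obj (op (.mk n))).X} :
    IsSpherical ((normHR r hr).onSSet K) n x ↔ HasZeroFaces K n (normToFree r hr _ x) := by
  cases n with
  | zero => exact Iff.rfl
  | succ n =>
    refine forall_congr' fun j => ?_
    rw [← normToFree_δ, ← normToFree_point r hr]
    exact (normToFree_injective r hr).eq_iff.symm

theorem mem_range_homologyHRTo_iff {α : (chains K).homology n} :
    α ∈ Set.range (fun x => homologyHRTo K n (homologyMap (normHRIncl r hr) K n x)) ↔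
      ∃ (c : K.obj (op (.mk n)) →₀ ℝ) (hc : HasZeroFaces K n c),
        homologyClass K n c hc.isCycle = α ∧ chainNorm c < r := by
  constructor
  · rintro ⟨⟨x, hx⟩, rfl⟩
    exact ⟨_, isSpherical_iff_hasZeroFaces.1 hx, rfl, l1Norm_normToFree_lt r hr x⟩
  · rintro ⟨c, hc, rfl, hlt⟩
    obtain ⟨x, rfl⟩ := exists_normToFree_eq r hr hlt
    exact ⟨Quot.mk _ ⟨x, isSpherical_iff_hasZeroFaces.2 hc⟩, rfl⟩

theorem mem_range_homologyHRTo_ofSimplex_comp_iff {K : SymmSimplexᵒᵖ ⥤ Type u}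
    {α : (chains (SymmSimplex.ofSimplex.op ⋙ K)).homology n} :
    α ∈ Set.range (fun x => homologyHRTo _ n (homologyMap (normHRIncl r hr) _ n x)) ↔
      ∃ c hc, homologyClass (SymmSimplex.ofSimplex.op ⋙ K) n c hc = α ∧ chainNorm c < r := by
  refine mem_range_homologyHRTo_iff.trans ⟨?_, ?_⟩
  · rintro ⟨c, hc, h⟩
    exact ⟨c, hc.isCycle, h⟩
  · rintro ⟨c, hc, rfl, hlt⟩
    obtain ⟨c', hc', h, hle⟩ := SymmSimplex.exists_hasZeroFaces c hc
    exact ⟨c', hc', h, hle.trans_lt hlt⟩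

theorem mem_range_rho_iff {X : TopCat.{u}} {α : H X n} :
    α ∈ Set.range (rho X n r hr) ↔ l1Seminorm X n α < r :=
  (mem_range_homologyHRTo_ofSimplex_comp_iff (K := SymmSimplex.sing X)).trans
    l1Seminorm_lt_iff.symm

end SModule

open SingularHomology SModule

theorem theorem1p1 (X : TopCat.{u}) (n : ℕ) (α : SingularHomology.H X n) :
    (∀ (r : ℝ) (hr : 0 < r),
      SingularHomology.l1Seminorm X n α < r ↔ α ∈ Set.range (SModule.rho X n r hr)) ∧
    SModule.ccSeminorm X n α = SingularHomology.l1Seminorm X n α := by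
  refine ⟨fun r hr => mem_range_rho_iff.symm, ?_⟩
  have hset : {r : ℝ | ∃ hr : 0 < r, α ∈ Set.range (rho X n r hr)} =
      Set.Ioi (l1Seminorm X n α) := by
    ext r
    simp only [mem_range_rho_iff, Set.mem_ofPred_eq, Set.mem_Ioi, exists_prop,
      and_iff_right_iff_imp]
    exact (l1Seminorm_nonneg X n α).trans_lt
  rw [ccSeminorm, hset, csInf_Ioi]
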